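/- Let $k$ be an algebraically closed field of characteristic zero and let $f\in k[x_0,\dots,x_n]$ be a reduced (square-free) homogeneous polynomial of degree $d\ge 3$ whose Hessian determinant $\det(\partial^2 f/\partial x_i\partial x_j)$ is identically zero. Put $f_i=\partial f/\partial x_i$, $X=V(f)\subset\mathbb{P}^n$ and $\mathrm{Sing}(X)=V(f_0,\dots,f_n)$. Let $g\in k[y_0,\dots,y_n]$ be an irreducible homogeneous polynomial with $g(f_0,\dots,f_n)=0$ such that the polynomials $g_i:=\frac{\partial g}{\partial y_i}(f_0,\dots,f_n)\in k[x_0,\dots,x_n]$, $i=0,\dots,n$, are not all zero. Let $\rho=\gcd(g_0,\dots,g_n)$ and $h_i=g_i/\rho$, and let $$\psi_g=(h_0:\dots:h_n)\colon\mathbb{P}^n\dashrightarrow\mathbb{P}^n,$$ a rational map defined outside its base locus $\mathrm{Bs}(\psi_g)=V(h_0,\dots,h_n)$. Let $S^*_Z=\overline{\psi_g(\mathbb{P}^n)}$ be the Zariski closure of its image, and for $q\in S^*_Z$ let $\overline{\psi_g^{-1}(q)}$ be the Zariski closure in $\mathbb{P}^n$ of the fibre $\psi_g^{-1}(q)\subset\mathbb{P}^n\setminus\mathrm{Bs}(\psi_g)$.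 Then for a general point $q\in S^*_Z$ (that is, for all $q$ in some Zariski open dense subset of $S^*_Z$) the following hold: 1. if $w\in\mathrm{Bs}(\psi_g)$ and $w\in\overline{\psi_g^{-1}(q)}\setminus\{q\}$, then the line $\langle w,q\rangle$ is contained in $\mathrm{Bs}(\psi_g)$; 2. if $t\in\mathrm{Sing}(X)$ and $t\in\overline{\psi_g^{-1}(q)}\setminus\{q\}$, then the line $\langle t,q\rangle$ is contained in $\mathrm{Sing}(X)$. -/

import Mathlib

namespace HessianGeometry

open MvPolynomial

noncomputable section

/-- The projective space `ℙⁿ` over `k`, as the set of lines through `0` in `k^(n+1)`. -/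
abbrev ProjSpace (k : Type*) [Field k] (n : ℕ) : Type _ :=
  Projectivization k (Fin (n + 1) → k)

/-- The ring `k[x₀, …, xₙ]`. -/
abbrev CoordRing (k : Type*) [Field k] (n : ℕ) : Type _ :=
  MvPolynomial (Fin (n + 1)) k

variable {k : Type*} [Field k] {n : ℕ}

/-- The set of points of `ℙⁿ` where all polynomials in `T` vanish. It is meant for (and only
used with) homogeneous polynomials, for which the choice of representative is irrelevant, see
`mk_mem_zeroLocus_iff`. -/
def zeroLocus (T : Set (CoordRing k n)) : Set (ProjSpace k n) :=
  {p | ∀ F ∈ T, eval p.rep F = 0}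

/-- A subset of `ℙⁿ` is Zariski open if it is the complement of the zero locus of a set of
homogeneous polynomials. -/
def IsZariskiOpen (U : Set (ProjSpace k n)) : Prop :=
  ∃ T : Set (CoordRing k n), (∀ F ∈ T, ∃ e : ℕ, F.IsHomogeneous e) ∧ U = (zeroLocus T)ᶜ

/-- The Zariski closure of `A`: the common zeros of all homogeneous polynomials vanishing on
`A`. -/
def zariskiClosure (A : Set (ProjSpace k n)) : Set (ProjSpace k n) :=
  zeroLocus {F | (∃ e : ℕ, F.IsHomogeneous e) ∧ ∀ p ∈ A, eval p.rep F = 0}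

/-- The line `⟨p, q⟩` joining two points. -/
def line (p q : ProjSpace k n) : Set (ProjSpace k n) :=
  (Projectivization.Subspace.span {p, q} : Projectivization.Subspace k (Fin (n + 1) → k))

/-- The Hessian polynomial `det (∂²f / ∂xᵢ∂xⱼ)`. -/
def hessianPoly (f : CoordRing k n) : CoordRing k n :=
  (Matrix.of fun i j => pderiv i (pderiv j f)).det

/-- The singular locus `V(f₀, …, fₙ)` of the hypersurface `V(f)`, where `fᵢ = ∂f/∂xᵢ`. -/
def singLocus (f : CoordRing k n) : Set (ProjSpace k n) :=
  zeroLocus (Set.range fun i => pderiv i f)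

/-- The polynomials `gᵢ = (∂g/∂yᵢ)(∂f/∂x₀, …, ∂f/∂xₙ)`, which define the composition of the polar
map of `f` with the polar map of `g`. -/
def polarComp (f g : CoordRing k n) (i : Fin (n + 1)) : CoordRing k n :=
  aeval (fun j => pderiv j f) (pderiv i g)

/-- The tuple `h` is obtained from `a` by dividing out a greatest common divisor `ρ` of the
entries of `a`. -/
def IsReductionOf (h a : Fin (n + 1) → CoordRing k n) : Prop :=
  ∃ ρ : CoordRing k n, (∀ i, a i = ρ * h i) ∧ ∀ δ : CoordRing k n, (∀ i, δ ∣ a i) → δ ∣ ρ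

/-- The base locus `V(h₀, …, hₙ)` of the rational map `(h₀ : … : hₙ)`, for forms `hᵢ` of the same
degree without common factor. -/
def baseLocus (h : Fin (n + 1) → CoordRing k n) : Set (ProjSpace k n) :=
  zeroLocus (Set.range h)

/-- The rational map `p ↦ (h₀(p) : … : hₙ(p))` as a function on the complement of its base locus.
For forms of the same degree the choice of representative is irrelevant, see `ratMap_mk`. -/
def ratMap (h : Fin (n + 1) → CoordRing k n) (p : {p : ProjSpace k n // p ∉ baseLocus h}) :
    ProjSpace k n :=
  Projectivization.mk k (fun i => eval p.1.rep (h i)) (fun h0 => p.2 (by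
    rintro _ ⟨i, rfl⟩
    exact congrFun h0 i))

/-- The closure of the image of the rational map `(h₀ : … : hₙ)`. -/
def imageClosure (h : Fin (n + 1) → CoordRing k n) : Set (ProjSpace k n) :=
  zariskiClosure (Set.range (ratMap h))

/-- The fibre over `q` of the rational map `(h₀ : … : hₙ)`, a subset of its domain of
definition. -/
def fiber (h : Fin (n + 1) → CoordRing k n) (q : ProjSpace k n) : Set (ProjSpace k n) :=
  Subtype.val '' (ratMap h ⁻¹' {q})

/-- A property holds for a general point of `S` if it holds on a Zariski open dense subset
of `S`. -/
def ForGeneralPoint (S : Set (ProjSpace k n)) (P : ProjSpace k n → Prop) : Prop :=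
  ∃ U : Set (ProjSpace k n), IsZariskiOpen U ∧ S ⊆ zariskiClosure (U ∩ S) ∧ ∀ q ∈ U ∩ S, P q

theorem eval_smul_of_isHomogeneous {F : CoordRing k n} {e : ℕ} (hF : F.IsHomogeneous e) (c : k)
    (v : Fin (n + 1) → k) : eval (c • v) F = c ^ e * eval v F := by
  simp only [eval_eq, Finset.mul_sum]
  refine Finset.sum_congr rfl fun m hm => ?_
  have hd : ∑ i, m i = e := by
    have := hF (mem_support_iff.mp hm)
    simpa [Finsupp.weight_apply, Finsupp.sum_fintype] using this
  simp only [Pi.smul_apply, smul_eq_mul, mul_pow, Finset.prod_mul_distrib]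
  have : ∏ i ∈ m.support, c ^ m i = c ^ e := by
    rw [Finset.prod_pow_eq_pow_sum, ← hd]
    congr 1
    exact Finset.sum_subset (Finset.subset_univ _) (by simp)
  rw [this]
  ring

theorem mk_mem_zeroLocus_iff {T : Set (CoordRing k n)} (hT : ∀ F ∈ T, ∃ e : ℕ, F.IsHomogeneous e)
    (v : Fin (n + 1) → k) (hv : v ≠ 0) :
    Projectivization.mk k v hv ∈ zeroLocus T ↔ ∀ F ∈ T, eval v F = 0 := by
  obtain ⟨c, hc⟩ := Projectivization.exists_smul_eq_mk_rep k v hv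
  refine forall₂_congr fun F hF => ?_
  obtain ⟨e, he⟩ := hT F hF
  rw [← hc, Units.smul_def, eval_smul_of_isHomogeneous he]
  simp

theorem ratMap_mk {h : Fin (n + 1) → CoordRing k n} {e : ℕ} (hh : ∀ i, (h i).IsHomogeneous e)
    (v : Fin (n + 1) → k) (hv : v ≠ 0) (hp : Projectivization.mk k v hv ∉ baseLocus h)
    (hw : (fun i => eval v (h i)) ≠ 0) :
    ratMap h ⟨Projectivization.mk k v hv, hp⟩ =
      Projectivization.mk k (fun i => eval v (h i)) hw := by
  obtain ⟨c, hc⟩ := Projectivization.exists_smul_eq_mk_rep k v hv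
  refine (Projectivization.mk_eq_mk_iff k _ _ _ _).mpr ⟨c ^ e, ?_⟩
  funext i
  simp only [← hc, Units.smul_def, eval_smul_of_isHomogeneous (hh i), Pi.smul_apply, smul_eq_mul,
    Units.val_pow_eq_pow_val]

end

end HessianGeometry

open HessianGeometry

namespace HessianGeometry

open MvPolynomial

noncomputable section

/-! ### Derivations of polynomial rings. -/

section ChainRule

variable {k σ : Type*} [Field k] [Fintype σ]

/-! Differentiating `g(f₀, …, fₙ) = 0` shows that `D = ∑ gᵢ ∂ᵢ` kills every `fⱼ`, hence every `gᵢ`.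
So `F(x + T g(x)) = exp(T D) F`, and comparing degrees in `T` shows that factors of nonzero elements
of `ker D` lie in `ker D`. Thus `D hᵢ = 0`, and `∑ hᵢ ∂ᵢ = D / ρ` kills all `hᵢ` and `fⱼ`
(`mkDerivation_reduction`, `mkDerivation_eq_zero_of_polarComp`).

For such `F`, `F(x + t h(x)) = F(x)`. On the fibre over `q`, `h(x)` is proportional to `q`, so `F(x
+ t q) = F(x)`, and this passes to the closure. A zero `w` of `F` there gives zeros along `⟨w, q⟩`.
No genericity of `q` is needed. -/

theorem derivation_aeval {τ : Type*} (D : Derivation k (MvPolynomial τ k) (MvPolynomial τ k))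
    (φ : σ → MvPolynomial τ k) (G : MvPolynomial σ k) :
    D (aeval φ G) = ∑ i, aeval φ (pderiv i G) * D (φ i) := by
  classical
  induction G using MvPolynomial.induction_on with
  | C a => simp [← MvPolynomial.algebraMap_eq]
  | add p q hp hq => simp only [map_add, hp, hq, add_mul, Finset.sum_add_distrib]
  | mul_X p j hp =>
    simp only [map_mul, aeval_X, Derivation.leibniz, smul_eq_mul, hp, map_add, pderiv_X, add_mul,
      Finset.sum_add_distrib, Finset.mul_sum]
    congr 1
    · rw [Finset.sum_eq_single j]
      · simp
      · intro b _ hb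
        simp [Ne.symm hb]
      · simp
    · exact Finset.sum_congr rfl fun i _ => by ring

theorem mkDerivation_eq_sum (a : σ → MvPolynomial σ k) (G : MvPolynomial σ k) :
    mkDerivation k a G = ∑ i, a i * pderiv i G := by
  have := derivation_aeval (mkDerivation k a) X G
  simp only [aeval_X_left, AlgHom.id_apply, mkDerivation_X] at this
  simpa only [mul_comm] using this

theorem pderiv_pderiv_swap {σ : Type*} (i j : σ) (F : MvPolynomial σ k) :
    pderiv i (pderiv j F) = pderiv j (pderiv i F) := by
  classical
  have : ⁅(pderiv i : Derivation k (MvPolynomial σ k) (MvPolynomial σ k)),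
      (pderiv j : Derivation k (MvPolynomial σ k) (MvPolynomial σ k))⁆ = 0 := by
    refine MvPolynomial.derivation_ext fun l => ?_
    simp [Derivation.commutator_apply, pderiv_X, Pi.single_apply, apply_ite]
  have h := DFunLike.congr_fun this F
  rwa [Derivation.commutator_apply, Derivation.zero_apply, sub_eq_zero] at h

end ChainRule

/-! ### The exponential of a derivation killing its own coefficients. -/

section Flow

variable {k σ : Type*} [Field k]

/-- The homomorphism `F(x) ↦ F(x + T a(x))`. -/
def flow (a : σ → MvPolynomial σ k) : MvPolynomial σ k →ₐ[k] Polynomial (MvPolynomial σ k) :=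
  aeval fun i => Polynomial.C (X i) + Polynomial.X * Polynomial.C (a i)

theorem flow_X (a : σ → MvPolynomial σ k) (i : σ) :
    flow a (X i) = Polynomial.C (X i) + Polynomial.X * Polynomial.C (a i) :=
  aeval_X _ _

theorem eval_eval_flow (a : σ → MvPolynomial σ k) (v : σ → k) (t : k) (F : MvPolynomial σ k) :
    Polynomial.eval₂ (eval v) t (flow a F) = eval (v + t • fun i => eval v (a i)) F := by
  induction F using MvPolynomial.induction_on with
  | C c => simp
  | add p q hp hq => simp only [map_add, Polynomial.eval₂_add, hp, hq]
  | mul_X p j hp => simp [Polynomial.eval₂_mul, flow_X, hp, mul_comm t]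

theorem coeff_zero_flow (a : σ → MvPolynomial σ k) (F : MvPolynomial σ k) :
    (flow a F).coeff 0 = F := by
  induction F using MvPolynomial.induction_on with
  | C c => simp
  | add p q hp hq => simp [hp, hq]
  | mul_X p j hp => simp [flow_X, hp, Polynomial.mul_coeff_zero]

variable {a : σ → MvPolynomial σ k}

/-- If `D = ∑ aᵢ ∂ᵢ` satisfies `D aᵢ = 0`, then `F(x + T a(x)) = ∑ Tᵐ Dᵐ F / m!`. -/
theorem coeff_succ_flow (ha : ∀ i, mkDerivation k a (a i) = 0) (F : MvPolynomial σ k) (m : ℕ) :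
    ((m : MvPolynomial σ k) + 1) * (flow a F).coeff (m + 1) =
      mkDerivation k a ((flow a F).coeff m) := by
  induction F using MvPolynomial.induction_on generalizing m with
  | C c => cases m <;> simp [Polynomial.coeff_C]
  | add p q hp hq => simp [mul_add, hp, hq]
  | mul_X p j hp =>
    rw [map_mul, flow_X, mul_add, ← mul_assoc]
    cases m with
    | zero =>
      have := hp 0
      simp only [Nat.cast_zero, zero_add, one_mul] at this
      simp [Polynomial.coeff_mul_X, this, Polynomial.mul_coeff_zero, mkDerivation_X]
      ring
    | succ m =>
      have h1 := hp (m + 1)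
      have h2 := hp m
      push_cast at h1
      simp only [Polynomial.coeff_add, Polynomial.coeff_mul_C, Polynomial.coeff_mul_X,
        map_add, Derivation.leibniz, smul_eq_mul, mkDerivation_X, ha, ← h1, ← h2]
      push_cast
      ring

/-- By `coeff_succ_flow`, one vanishing derivative kills the next coefficient, since `m + 1` is
invertible in characteristic zero. -/
theorem flow_eq_C [CharZero k] (ha : ∀ i, mkDerivation k a (a i) = 0) {F : MvPolynomial σ k}
    (hF : mkDerivation k a F = 0) : flow a F = Polynomial.C F := by
  have step : ∀ m, mkDerivation k a ((flow a F).coeff m) = 0 →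
      (flow a F).coeff (m + 1) = 0 := by
    intro m h0
    have h := coeff_succ_flow ha F m
    rw [h0] at h
    exact (mul_eq_zero.mp h).resolve_left (by exact_mod_cast m.succ_ne_zero)
  have key : ∀ m, (flow a F).coeff (m + 1) = 0 := by
    intro m
    induction m with
    | zero => exact step 0 (by rwa [coeff_zero_flow])
    | succ m ih => exact step (m + 1) (by rw [ih, map_zero])
  ext1 m
  cases m with
  | zero => simp [coeff_zero_flow]
  | succ m => simp [key]

/-- The kernel of `D = ∑ aᵢ ∂ᵢ` with `D aᵢ = 0` is factorially closed. -/
theorem mkDerivation_eq_zero_of_mul [CharZero k] (ha : ∀ i, mkDerivation k a (a i) = 0)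
    {F G : MvPolynomial σ k} (hFG : mkDerivation k a (F * G) = 0) (h0 : F * G ≠ 0) :
    mkDerivation k a F = 0 := by
  have h := flow_eq_C ha hFG
  rw [map_mul] at h
  have hd := congrArg Polynomial.natDegree h
  have hne : flow a F * flow a G ≠ 0 := by rw [h]; simpa using h0
  -- Degrees in `T` add up to 0, so `flow a F` is constant and its linear coefficient `D F`
  -- vanishes.
  rw [Polynomial.natDegree_mul (left_ne_zero_of_mul hne) (right_ne_zero_of_mul hne),
    Polynomial.natDegree_C] at hd
  have h1 := coeff_succ_flow ha F 0
  rw [Polynomial.coeff_eq_zero_of_natDegree_lt (by omega), coeff_zero_flow] at h1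
  simpa using h1.symm

end Flow

/-! ### Factors of homogeneous polynomials. -/

section Scaling

variable {k σ : Type*} [Field k]

/-- The homomorphism `F(x) ↦ F(T x)`. -/
def scaling : MvPolynomial σ k →ₐ[k] Polynomial (MvPolynomial σ k) :=
  aeval fun i => Polynomial.C (X i) * Polynomial.X

theorem scaling_C (c : k) : scaling (C c : MvPolynomial σ k) = Polynomial.C (C c) := by
  simp [scaling, ← MvPolynomial.algebraMap_eq]

theorem eval_eval_scaling (v : σ → k) (t : k) (F : MvPolynomial σ k) :
    Polynomial.eval₂ (eval v) t (scaling F) = eval (t • v) F := by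
  induction F using MvPolynomial.induction_on with
  | C c => simp
  | add p q hp hq => simp only [map_add, Polynomial.eval₂_add, hp, hq]
  | mul_X p j hp =>
    have : scaling (X j : MvPolynomial σ k) = Polynomial.C (X j) * Polynomial.X := aeval_X _ _
    simp only [map_mul, this, Polynomial.eval₂_mul, hp, Polynomial.eval₂_C, Polynomial.eval₂_X,
      eval_X, Pi.smul_apply, smul_eq_mul, mul_comm t]

theorem eval_one_scaling (F : MvPolynomial σ k) : Polynomial.eval 1 (scaling F) = F := by
  induction F using MvPolynomial.induction_on with
  | C c => simp
  | add p q hp hq => simp [hp, hq]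
  | mul_X p j hp =>
    have : scaling (X j : MvPolynomial σ k) = Polynomial.C (X j) * Polynomial.X := aeval_X _ _
    simp [this, hp]

theorem scaling_of_isHomogeneous {F : MvPolynomial σ k} {e : ℕ} (hF : F.IsHomogeneous e) :
    scaling F = Polynomial.monomial e F := by
  have key : ∀ m ∈ F.support, scaling (monomial m (coeff m F)) =
      Polynomial.monomial e (monomial m (coeff m F)) := by
    intro m hm
    have hd : ∑ i ∈ m.support, m i = e := by
      have := hF (mem_support_iff.mp hm)
      simpa [Finsupp.weight_apply, Finsupp.sum] using this
    rw [monomial_eq, map_mul, scaling_C, Finsupp.prod, map_prod]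
    have : ∀ i, scaling (X i ^ m i : MvPolynomial σ k) =
        Polynomial.C (X i ^ m i) * Polynomial.X ^ m i := fun i => by
      rw [map_pow, show scaling (X i : MvPolynomial σ k) = Polynomial.C (X i) * Polynomial.X from
        aeval_X _ _, mul_pow, Polynomial.C_pow]
    simp only [this, Finset.prod_mul_distrib, Finset.prod_pow_eq_pow_sum, hd,
      ← Polynomial.C_mul_X_pow_eq_monomial, map_mul, map_prod, mul_assoc]
  conv_lhs => rw [F.as_sum]
  conv_rhs => rw [F.as_sum]
  rw [map_sum, map_sum]
  exact Finset.sum_congr rfl key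

/-- The product of the two scalings is a monomial in `T`. Degree and trailing degree are both
additive, so they agree on each factor. -/
theorem eval_smul_of_mul_isHomogeneous {F G : MvPolynomial σ k} {e : ℕ}
    (hFG : (F * G).IsHomogeneous e) (h0 : F * G ≠ 0) :
    ∃ m : ℕ, ∀ (c : k) (v : σ → k), eval (c • v) F = c ^ m * eval v F := by
  have h := scaling_of_isHomogeneous hFG
  rw [map_mul] at h
  have hne : scaling F * scaling G ≠ 0 := by rw [h]; simpa using h0
  have hd := congrArg Polynomial.natDegree h
  have ht := congrArg Polynomial.natTrailingDegree h
  rw [Polynomial.natDegree_mul (left_ne_zero_of_mul hne) (right_ne_zero_of_mul hne),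
    Polynomial.natDegree_monomial_eq _ h0] at hd
  rw [Polynomial.natTrailingDegree_mul (left_ne_zero_of_mul hne) (right_ne_zero_of_mul hne),
    Polynomial.natTrailingDegree_monomial h0] at ht
  have h1 := Polynomial.natTrailingDegree_le_natDegree (scaling F)
  have h2 := Polynomial.natTrailingDegree_le_natDegree (scaling G)
  have hF : scaling F = Polynomial.monomial (scaling F).natDegree F := by
    have hmon : scaling F = Polynomial.monomial (scaling F).natDegree
        ((scaling F).coeff (scaling F).natDegree) := by
      ext1 m
      rw [Polynomial.coeff_monomial]
      split_ifs with hm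
      · rw [hm]
      · rcases lt_or_gt_of_ne hm with hm | hm
        · exact Polynomial.coeff_eq_zero_of_natDegree_lt hm
        · exact Polynomial.coeff_eq_zero_of_lt_natTrailingDegree (by omega)
    have h3 := eval_one_scaling F
    rw [hmon, Polynomial.eval_monomial, one_pow, mul_one] at h3
    rwa [h3] at hmon
  refine ⟨(scaling F).natDegree, fun c v => ?_⟩
  rw [← eval_eval_scaling, hF, Polynomial.eval₂_monomial, mul_comm, ← hF]

end Scaling

/-! ### Closures of fibres and lines. -/

section Projective

variable {k : Type*} [Field k] {n : ℕ}

/-- For inhomogeneous `G`, vanishing on the punctured cone over `A` forces each homogeneous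
component to vanish on `A`, as `k` is infinite. -/
theorem eval_eq_zero_of_mem_zariskiClosure [Infinite k] {A : Set (ProjSpace k n)}
    {G : CoordRing k n} (hG : ∀ p ∈ A, ∀ c : k, c ≠ 0 → eval (c • p.rep) G = 0)
    {w : ProjSpace k n} (hw : w ∈ zariskiClosure A) : eval w.rep G = 0 := by
  rw [← sum_homogeneousComponent G, map_sum]
  refine Finset.sum_eq_zero fun j hj => ?_
  refine hw _ ⟨⟨j, homogeneousComponent_isHomogeneous j G⟩, fun p hp => ?_⟩
  let P : Polynomial k := ∑ i ∈ Finset.range (G.totalDegree + 1),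
    Polynomial.monomial i (eval p.rep (homogeneousComponent i G))
  have hP : P = 0 := by
    refine Polynomial.eq_zero_of_infinite_isRoot _ ?_
    refine (Set.finite_singleton (0 : k)).infinite_compl.mono fun c hc => ?_
    have h := hG p hp c hc
    rw [← sum_homogeneousComponent G, map_sum] at h
    simp only [eval_smul_of_isHomogeneous (homogeneousComponent_isHomogeneous _ G)] at h
    simpa [P, Polynomial.eval_finsetSum, mul_comm] using h
  have h := congrArg (fun Q => Polynomial.coeff Q j) hP
  simpa [P, Polynomial.finsetSum_coeff, Polynomial.coeff_monomial,
    Finset.mem_range.mp hj] using h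

theorem exists_rep_eq_of_mem_line {p q x : ProjSpace k n} (hx : x ∈ line p q) :
    ∃ a b : k, x.rep = a • p.rep + b • q.rep := by
  have hle : Projectivization.Subspace.span {p, q} ≤
      (Submodule.span k {p.rep, q.rep}).projectivization := by
    rw [Projectivization.Subspace.span_le_subspace_iff]
    rintro y (rfl | rfl)
    · rw [← Projectivization.mk_rep y]
      exact (Submodule.mk_mem_projectivization_iff _ _).mpr
        (Submodule.subset_span (by simp [Projectivization.mk_rep]))
    · rw [← Projectivization.mk_rep y]
      exact (Submodule.mk_mem_projectivization_iff _ _).mpr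
        (Submodule.subset_span (by simp [Projectivization.mk_rep]))
  have h := hle hx
  rw [← Projectivization.mk_rep x, Submodule.mk_mem_projectivization_iff _ x.rep_nonzero,
    Submodule.mem_span_pair] at h
  obtain ⟨a, b, h⟩ := h
  exact ⟨a, b, h.symm⟩

/-- If `F(x + t h(x)) = F(x)`, then `F(w + t q) = F(w)` for `w` in the closure of the fibre
over `q`. -/
theorem eval_add_smul_of_mem_zariskiClosure_fiber [Infinite k] {h : Fin (n + 1) → CoordRing k n}
    {F : CoordRing k n} (hF : flow h F = Polynomial.C F) {m : ℕ}
    (hm : ∀ (c : k) (v : Fin (n + 1) → k), eval (c • v) F = c ^ m * eval v F)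
    {q w : ProjSpace k n} (hw : w ∈ zariskiClosure (fiber h q)) (t : k) :
    eval (w.rep + t • q.rep) F = eval w.rep F := by
  let G : CoordRing k n := aeval (fun i => X i + C (t * q.rep i)) F - F
  have hG : ∀ v, eval v G = eval (v + t • q.rep) F - eval v F := by
    intro v
    simp only [G, map_sub, sub_left_inj]
    rw [← MvPolynomial.coe_aeval_eq_eval, ← MvPolynomial.coe_aeval_eq_eval]
    simp only [RingHom.coe_coe, ← AlgHom.comp_apply, MvPolynomial.comp_aeval]
    congr 2
    funext i
    simp
  rw [← sub_eq_zero, ← hG]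
  refine eval_eq_zero_of_mem_zariskiClosure ?_ hw
  rintro p ⟨⟨p, hp⟩, hpq, rfl⟩ c hc
  have hpq : Projectivization.mk k (fun i => eval p.rep (h i)) _ = q := hpq
  obtain ⟨u, hu⟩ := Projectivization.exists_smul_eq_mk_rep k (fun i => eval p.rep (h i))
    (fun h0 => hp (by rintro _ ⟨i, rfl⟩; exact congrFun h0 i))
  rw [hpq] at hu
  -- On the fibre, `q.rep` is a multiple of `h(p)`, so translating by `q` is moving along the flow.
  have key : c • p.rep + t • q.rep =
      c • (p.rep + (c⁻¹ * t * (u : k)) • fun i => eval p.rep (h i)) := by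
    rw [← hu, Units.smul_def, smul_add, smul_smul, smul_smul]
    congr 2
    field_simp
  rw [hG, key, hm, hm, ← eval_eval_flow, hF, Polynomial.eval₂_C, sub_self]

theorem eval_eq_zero_of_mem_line [Infinite k] {F : CoordRing k n} {m : ℕ}
    (hm : ∀ (c : k) (v : Fin (n + 1) → k), eval (c • v) F = c ^ m * eval v F)
    {w q : ProjSpace k n} (hF : ∀ t : k, eval (w.rep + t • q.rep) F = 0)
    {x : ProjSpace k n} (hx : x ∈ line w q) : eval x.rep F = 0 := by
  obtain ⟨a, b, hab⟩ := exists_rep_eq_of_mem_line hx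
  -- The coefficient `a` becomes a variable: nonzero values rescale to `w + t q`, and the case `a =
  -- 0`, the point `q`, follows by polynomial identity.
  let P : Polynomial k :=
    aeval (fun i => Polynomial.C (w.rep i) * Polynomial.X + Polynomial.C (b * q.rep i)) F
  have hP : ∀ s, P.eval s = eval (s • w.rep + b • q.rep) F := by
    intro s
    rw [← Polynomial.coe_aeval_eq_eval, ← MvPolynomial.coe_aeval_eq_eval]
    simp only [P, RingHom.coe_coe, ← AlgHom.comp_apply, MvPolynomial.comp_aeval]
    congr 2
    funext i
    simp [mul_comm s]
  have hP0 : P = 0 := by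
    refine Polynomial.eq_zero_of_infinite_isRoot _ ?_
    refine (Set.finite_singleton (0 : k)).infinite_compl.mono fun s hs => ?_
    have hs : s ≠ 0 := hs
    have : s • w.rep + b • q.rep = s • (w.rep + (s⁻¹ * b) • q.rep) := by
      rw [smul_add, smul_smul, mul_inv_cancel_left₀ hs]
    rw [Set.mem_ofPred_eq, Polynomial.IsRoot.def, hP, this, hm, hF, mul_zero]
  rw [hab, ← hP, hP0, Polynomial.eval_zero]

end Projective

/-! ### The derivation attached to the polar relation. -/

section PolarComposition

variable {k : Type*} [Field k] {n : ℕ} {f g : CoordRing k n}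

/-- This is `∂ⱼ` of the relation, by the chain rule and the symmetry of the Hessian matrix. -/
theorem mkDerivation_polarComp_pderiv (hg_rel : aeval (fun i => pderiv i f) g = 0)
    (j : Fin (n + 1)) : mkDerivation k (polarComp f g) (pderiv j f) = 0 := by
  have h := derivation_aeval (pderiv j) (fun i => pderiv i f) g
  rw [hg_rel, map_zero] at h
  rw [mkDerivation_eq_sum, h]
  exact Finset.sum_congr rfl fun i _ => by rw [pderiv_pderiv_swap]; rfl

theorem mkDerivation_polarComp_polarComp (hg_rel : aeval (fun i => pderiv i f) g = 0)
    (i : Fin (n + 1)) : mkDerivation k (polarComp f g) (polarComp f g i) = 0 := by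
  rw [polarComp, derivation_aeval]
  exact Finset.sum_eq_zero fun j _ => by rw [mkDerivation_polarComp_pderiv hg_rel, mul_zero]

variable {h : Fin (n + 1) → CoordRing k n} {ρ : CoordRing k n}

theorem mkDerivation_eq_zero_of_polarComp (hρ : ρ ≠ 0) (hh : ∀ i, polarComp f g i = ρ * h i)
    {F : CoordRing k n} (hF : mkDerivation k (polarComp f g) F = 0) : mkDerivation k h F = 0 := by
  simp only [mkDerivation_eq_sum, hh, mul_assoc, ← Finset.mul_sum] at hF ⊢
  exact (mul_eq_zero.mp hF).resolve_left hρ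

/-- `hᵢ` divides `gᵢ`, which lies in the factorially closed kernel of `D`; then `ρ` cancels. -/
theorem mkDerivation_reduction [CharZero k] (hg_rel : aeval (fun i => pderiv i f) g = 0)
    (hρ : ρ ≠ 0) (hh : ∀ i, polarComp f g i = ρ * h i) (i : Fin (n + 1)) :
    mkDerivation k h (h i) = 0 := by
  rcases eq_or_ne (h i) 0 with h0 | h0
  · rw [h0, map_zero]
  · refine mkDerivation_eq_zero_of_polarComp hρ hh
      (mkDerivation_eq_zero_of_mul (mkDerivation_polarComp_polarComp hg_rel) (G := ρ) ?_
        (mul_ne_zero h0 hρ))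
    rw [mul_comm, ← hh, mkDerivation_polarComp_polarComp hg_rel]

theorem reduction_eval_smul {d e : ℕ} (hf : f.IsHomogeneous d) (hg : g.IsHomogeneous e)
    (hρ : ρ ≠ 0) (hh : ∀ i, polarComp f g i = ρ * h i) (i : Fin (n + 1)) :
    ∃ m : ℕ, ∀ (c : k) (v : Fin (n + 1) → k), eval (c • v) (h i) = c ^ m * eval v (h i) := by
  rcases eq_or_ne (h i) 0 with h0 | h0
  · exact ⟨0, by simp [h0]⟩
  · have hom : (polarComp f g i).IsHomogeneous ((d - 1) * (e - 1)) :=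
      hg.pderiv.aeval _ fun j => hf.pderiv
    rw [hh, mul_comm] at hom
    exact eval_smul_of_mul_isHomogeneous hom (mul_ne_zero h0 hρ)

end PolarComposition

theorem forGeneralPoint_of_forall {k : Type*} [Field k] {n : ℕ} {S : Set (ProjSpace k n)}
    {P : ProjSpace k n → Prop} (hP : ∀ q, P q) : ForGeneralPoint S P := by
  refine ⟨Set.univ, ⟨{1}, ?_, ?_⟩, ?_, fun q _ => hP q⟩
  · rintro F rfl
    exact ⟨0, isHomogeneous_one _ _⟩
  · symm
    rw [Set.compl_univ_iff, Set.eq_empty_iff_forall_notMem]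
    intro p hp
    simpa using hp 1 rfl
  · rw [Set.univ_inter]
    exact fun p hp F hF => hF.2 p hp

end

end HessianGeometry

theorem mainTheorem7 {k : Type*} [Field k] [IsAlgClosed k] [CharZero k] (n d : ℕ)
    (f g : CoordRing k n) (h : Fin (n + 1) → CoordRing k n)
    -- `f` is a reduced form of degree at least 3 with vanishing Hessian
    (hd : 3 ≤ d) (hf : f.IsHomogeneous d) (hf_red : Squarefree f) (hf_hess : hessianPoly f = 0)
    -- `V(g)` is an irreducible and reduced hypersurface containing the polar image of `f`,
    -- which is not contained in the singular locus of `V(g)`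
    (hg : ∃ e : ℕ, g.IsHomogeneous e) (hg_irr : Irreducible g)
    (hg_rel : MvPolynomial.aeval (fun i => MvPolynomial.pderiv i f) g = 0)
    (hg_sing : ∃ i, polarComp f g i ≠ 0)
    -- `h` is the tuple `(g₀, …, gₙ)` divided by its greatest common divisor
    (hh : IsReductionOf h (polarComp f g)) :
    ForGeneralPoint (imageClosure h) fun q =>
      (∀ w ∈ baseLocus h, w ∈ zariskiClosure (fiber h q) \ {q} → line w q ⊆ baseLocus h) ∧
      (∀ t ∈ singLocus f, t ∈ zariskiClosure (fiber h q) \ {q} → line t q ⊆ singLocus f) := by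
  obtain ⟨e, hg⟩ := hg
  obtain ⟨ρ, hρh, -⟩ := hh
  have hρ : ρ ≠ 0 := by
    rintro rfl
    obtain ⟨i, hi⟩ := hg_sing
    exact hi (by rw [hρh, zero_mul])
  have hself := mkDerivation_reduction hg_rel hρ hρh
  refine forGeneralPoint_of_forall fun q => ⟨?_, ?_⟩
  · rintro w hw ⟨hwq, -⟩ x hx _ ⟨i, rfl⟩
    obtain ⟨m, hm⟩ := reduction_eval_smul hf hg hρ hρh i
    refine eval_eq_zero_of_mem_line hm (fun t => ?_) hx
    rw [eval_add_smul_of_mem_zariskiClosure_fiber (flow_eq_C hself (hself i)) hm hwq]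
    exact hw _ ⟨i, rfl⟩
  · rintro w hw ⟨hwq, -⟩ x hx _ ⟨i, rfl⟩
    have hm := eval_smul_of_isHomogeneous (hf.pderiv (i := i))
    refine eval_eq_zero_of_mem_line hm (fun t => ?_) hx
    rw [eval_add_smul_of_mem_zariskiClosure_fiber (flow_eq_C hself
      (mkDerivation_eq_zero_of_polarComp hρ hρh (mkDerivation_polarComp_pderiv hg_rel i))) hm hwq]
    exact hw _ ⟨i, rfl⟩
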